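/- For $n\ge 2$ let $\mathbf Q=(Q_1,\dots,Q_n)$ be uniformly distributed on the set of the $n!$ permutations of $\{1,\dots,n\}$, and let $$Z_j=\sqrt{\tfrac{12}{n^2-1}}\Bigl(Q_j-\tfrac{n+1}{2}\Bigr),\qquad j=1,\dots,n.$$ For bounded random variables $\xi_1,\dots,\xi_N$ the joint cumulant is $$\mathbf C(\xi_1,\dots,\xi_N)=\mathrm i^{-N}\frac{\partial^N}{\partial x_1\cdots\partial x_N}\log\mathbb E\exp\Bigl(\sum_{j=1}^N\mathrm i x_j\xi_j\Bigr)\Big|_{x_1=\cdots=x_N=0};$$ it is symmetric, so $\mathbf C\{\xi_\alpha\}_{\alpha\in A}$ makes sense for a finite index set $A$. Fix a positive integer $k$, a partition $\pi$ of $\{1,\dots,2k\}$ all of whose blocks have even cardinality, and a partition $\pi_1$ of $\{1,\dots,2k\}$ all of whose blocks have exactly two elements. Let $\pi\vee\pi_1$ be the least upper bound of $\pi$ and $\pi_1$ in the lattice of partitions ordered by refinement, let $B$ be a block of $\pi\vee\pi_1$, let $A^{(1)},\dots,A^{(m)}$ be the blocks of $\pi$ contained in $B$, and put $\mathfrak a(\beta)=\#A^{(\beta)}/2$.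 Let $\mathcal J_n$ be the set of all $\pi_1|_B$-measurable words, that is, of all families $(j_\alpha)_{\alpha\in B}$ with $j_\alpha\in\{1,\dots,n\}$ such that $j_\alpha=j_{\alpha'}$ whenever $\alpha,\alpha'\in B$ lie in the same block of $\pi_1$. Then, as $n\to\infty$ with $k,\pi,\pi_1,B$ fixed, $$\sum_{(j_\alpha)_{\alpha\in B}\in\mathcal J_n}\ \prod_{\beta=1}^m\bigl|\mathbf C\{Z_{j_\alpha}\}_{\alpha\in A^{(\beta)}}\bigr|=O\Bigl(n^{\,1+\sum_{\beta=1}^m(\mathfrak a(\beta)-2)\mathbf 1_{\{\mathfrak a(\beta)\ge2\}}}\Bigr).$$ -/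

import Mathlib

open Finset MeasureTheory Asymptotics

namespace SpearmanRank

/-- The logarithm of the joint characteristic function of `ξ 0, …, ξ (N - 1)`:
`x ↦ log 𝔼 exp (∑ j, i x_j ξ_j)`. -/
noncomputable def logCharFun {Ω : Type*} [MeasurableSpace Ω] (P : Measure Ω) {N : ℕ}
    (ξ : Fin N → Ω → ℝ) (x : Fin N → ℝ) : ℂ :=
  Complex.log (∫ ω, Complex.exp (∑ j, Complex.I * (x j : ℂ) * (ξ j ω : ℂ)) ∂P)

/-- The joint cumulant
`C(ξ_1, …, ξ_N) = i^{-N} ∂^N / (∂x_1 ⋯ ∂x_N) log 𝔼 exp (∑ j, i x_j ξ_j)` at `x = 0`.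
The mixed partial derivative is the `N`-th derivative applied to the standard basis vectors. -/
noncomputable def jointCumulant {Ω : Type*} [MeasurableSpace Ω] (P : Measure Ω) {N : ℕ}
    (ξ : Fin N → Ω → ℝ) : ℂ :=
  (Complex.I ^ N)⁻¹ *
    iteratedFDeriv ℝ N (logCharFun P ξ) 0 (fun j : Fin N => (Pi.single j 1 : Fin N → ℝ))

/-- The joint cumulant `C{ξ_a}_{a ∈ A}` of the subfamily of `ξ` indexed by a finite set `A`
of positions (listed in increasing order; the value does not depend on the order). -/
noncomputable def jointCumulantOn {Ω : Type*} [MeasurableSpace Ω] (P : Measure Ω)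
    {ι : Type*} [LinearOrder ι] (ξ : ι → Ω → ℝ) (A : Finset ι) : ℂ :=
  jointCumulant P (fun i : Fin A.card => ξ (A.orderEmbOfFin rfl i))

/-- Every set of permutations of a finite set is an event. -/
instance permMeasurableSpace (n : ℕ) : MeasurableSpace (Equiv.Perm (Fin n)) := ⊤

/-- The uniform distribution on the `n!` permutations of an `n`-element set. -/
noncomputable def uniformPerm (n : ℕ) : Measure (Equiv.Perm (Fin n)) :=
  (PMF.uniformOfFintype (Equiv.Perm (Fin n))).toMeasure

/-- The rank `Q_j`, with values in `{1, …, n}`; under `uniformPerm n` the vector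
`(Q_1, …, Q_n)` is uniformly distributed on the permutations of `{1, …, n}`. -/
def rankQ (n : ℕ) (j : Fin n) (s : Equiv.Perm (Fin n)) : ℕ := (s j : ℕ) + 1

/-- The normalized rank `Z_j = √(12 / (n² - 1)) (Q_j - (n + 1) / 2)`. -/
noncomputable def rankZ (n : ℕ) (j : Fin n) (s : Equiv.Perm (Fin n)) : ℝ :=
  Real.sqrt (12 / ((n : ℝ) ^ 2 - 1)) * ((rankQ n j s : ℝ) - ((n : ℝ) + 1) / 2)

/-- The join `π ∨ ρ` of two partitions: the partition into the classes of the equivalence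
relation generated by "being in a common block of `π` or of `ρ`". -/
noncomputable def join {α : Type*} [Fintype α] [DecidableEq α]
    (π ρ : Finpartition (univ : Finset α)) : Finpartition (univ : Finset α) :=
  letI : DecidableRel (Setoid.ker π.part ⊔ Setoid.ker ρ.part).r := Classical.decRel _
  Finpartition.ofSetoid (Setoid.ker π.part ⊔ Setoid.ker ρ.part)

/-- The join is the least upper bound for the refinement order. -/
theorem isLUB_join {α : Type*} [Fintype α] [DecidableEq α]
    (π ρ : Finpartition (univ : Finset α)) : IsLUB {π, ρ} (join π ρ) := by
  classical
  have key : ∀ a b : α, b ∈ (join π ρ).part a ↔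
      (Setoid.ker π.part ⊔ Setoid.ker ρ.part) a b := by
    intro a b
    unfold join
    exact Finpartition.mem_part_ofSetoid_iff_rel
  have mem_same : ∀ (τ : Finpartition (univ : Finset α)) (A : Finset α), A ∈ τ.parts →
      ∀ a ∈ A, τ.part a = A := fun τ A hA a ha => τ.part_eq_of_mem hA ha
  have le_of : ∀ τ : Finpartition (univ : Finset α),
      Setoid.ker τ.part ≤ Setoid.ker π.part ⊔ Setoid.ker ρ.part → τ ≤ join π ρ := by
    intro τ hτ A hA
    obtain ⟨a, ha⟩ := τ.nonempty_of_mem_parts hA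
    refine ⟨(join π ρ).part a, (join π ρ).part_mem.2 (mem_univ a), ?_⟩
    intro b hb
    refine (key a b).2 (hτ ?_)
    change τ.part a = τ.part b
    rw [mem_same τ A hA a ha, mem_same τ A hA b hb]
  constructor
  · rintro τ (rfl | rfl)
    · exact le_of _ le_sup_left
    · exact le_of _ le_sup_right
  · intro τ hτ
    have hker : ∀ η ∈ ({π, ρ} : Set (Finpartition (univ : Finset α))),
        Setoid.ker η.part ≤ Setoid.ker τ.part := by
      intro η hη a b hab
      change η.part a = η.part b at hab
      change τ.part a = τ.part b
      obtain ⟨D, hD, hsub⟩ := hτ hη (η.part_mem.2 (mem_univ a))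
      have haD : a ∈ D := hsub (η.mem_part (mem_univ a))
      have hbD : b ∈ D := hsub (hab ▸ η.mem_part (mem_univ b))
      rw [mem_same τ D hD a haD, mem_same τ D hD b hbD]
    have hle : Setoid.ker π.part ⊔ Setoid.ker ρ.part ≤ Setoid.ker τ.part :=
      sup_le (hker π (by simp)) (hker ρ (by simp))
    intro A hA
    obtain ⟨a, ha⟩ := (join π ρ).nonempty_of_mem_parts hA
    refine ⟨τ.part a, τ.part_mem.2 (mem_univ a), ?_⟩
    intro b hb
    have h1 : b ∈ (join π ρ).part a := by rw [mem_same _ A hA a ha]; exact hb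
    have h2 : τ.part a = τ.part b := hle ((key a b).1 h1)
    rw [h2]
    exact τ.mem_part (mem_univ b)

/-- The blocks of `π` contained in `B`, that is, the restriction `π|_B`. -/
def blocksIn {α : Type*} [Fintype α] [DecidableEq α]
    (π : Finpartition (univ : Finset α)) (B : Finset α) : Finset (Finset α) :=
  π.parts.filter (fun A => A ⊆ B)

/-- The set of all `σ|_B`-measurable words `(j_a)_{a ∈ B}` with letters in an `n`-element
alphabet: words that are constant on each block of `σ` contained in `B`. -/
noncomputable def measurableWords {α : Type*} [Fintype α] [DecidableEq α]
    (σ : Finpartition (univ : Finset α)) (B : Finset α) (n : ℕ) :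
    Finset ({a // a ∈ B} → Fin n) :=
  haveI := Classical.decPred (fun j : {a // a ∈ B} → Fin n =>
    ∀ D ∈ blocksIn σ B, ∀ a b : {a // a ∈ B}, (a : α) ∈ D → (b : α) ∈ D → j a = j b)
  univ.filter (fun j =>
    ∀ D ∈ blocksIn σ B, ∀ a b : {a // a ∈ B}, (a : α) ∈ D → (b : α) ∈ D → j a = j b)

/-- For a word `j` on `B` and a set `A` of positions, the joint cumulant `C{Z_{j_a}}_{a ∈ A}`.
It is used only for `A ⊆ B`, when `A ∩ B` (as a set of elements of `B`) is `A` itself. -/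
noncomputable def wordCumulant {α : Type*} [LinearOrder α] {B : Finset α} {n : ℕ}
    (j : {a // a ∈ B} → Fin n) (A : Finset α) : ℂ :=
  jointCumulantOn (uniformPerm n) (fun a : {a // a ∈ B} => rankZ n (j a))
    (A.subtype (fun a => a ∈ B))

/-- Half of the cardinality of a block of even cardinality. -/
def halfCard {α : Type*} (A : Finset α) : ℕ := A.card / 2

end SpearmanRank

/-! The sum is in fact `O(n)`, and the claimed exponent is at least 1. Three facts combine.

Decay: a joint cumulant of bounded functions of `r` distinct entries of a uniform permutation is
`O(n ^ (1 - r))` (`exists_norm_permCumulant_le`). The proof is by induction on the order. If a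
letter `j` repeats, `C(X, Y, …)` equals `C(XY, …)` minus a Leibniz sum of products of cumulants of
lower order; the two factors of each product share `j`, so no power of `n` is lost. If all letters
differ, the sum of `g (σ i)` over all `i` is constant, so the cumulants with `i` in the first slot
add up to zero. By exchangeability the `n - M` fresh letters give equal terms, so one such term is
`O(1/n)` times cumulants with a repeated letter.

Connectivity: on a block of the join, the letter sets of the blocks of `π` form a connected
hypergraph. A word with `r` letters in all therefore satisfies `r - 1 ≤ ∑ (r_β - 1)`, where `r_β`
counts the letters on the block `β` (`card_image_word_le`), and its product of cumulants is `O(n ^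
(1 - r))`.

Counting: `O(n ^ r)` words have exactly `r` letters (`sum_inv_pow_card_image_le`), so each `r`
contributes `O(n)`. -/

namespace SpearmanRank

open Filter Topology

/-! ### Calculus of iterated directional derivatives of analytic functions. -/

section DirectionalDerivatives

variable {V W : Type*} [NormedAddCommGroup V] [NormedSpace ℝ V]
  [NormedAddCommGroup W] [NormedSpace ℝ W]

/-- The iterated directional derivative along a list of directions, the head being applied
first. -/
noncomputable def dirDerivs : List V → (V → ℂ) → V → ℂ
  | [], F => F
  | v :: l, F => dirDerivs l (fun x => fderiv ℝ F x v)

theorem dirDerivs_congr (l : List V) : ∀ {F G : V → ℂ} {x : V}, F =ᶠ[𝓝 x] G →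
    dirDerivs l F =ᶠ[𝓝 x] dirDerivs l G := by
  induction l with
  | nil => exact fun h => h
  | cons v l ih =>
    intro F G x h
    exact ih ((h.fderiv (𝕜 := ℝ)).mono fun y hy => by simp only [hy])

theorem analyticAt_fderiv_apply {F : V → ℂ} {x : V} (h : AnalyticAt ℝ F x) (v : V) :
    AnalyticAt ℝ (fun y => fderiv ℝ F y v) x :=
  ((ContinuousLinearMap.apply ℝ ℂ v).analyticAt _).comp h.fderiv

theorem dirDerivs_append_singleton (l : List V) (v : V) : ∀ F : V → ℂ,
    dirDerivs (l ++ [v]) F = fun x => fderiv ℝ (dirDerivs l F) x v := by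
  induction l with
  | nil => exact fun F => rfl
  | cons w l ih => exact fun F => ih _

theorem dirDerivs_add (l : List V) : ∀ {F G : V → ℂ} {x : V}, AnalyticAt ℝ F x →
    AnalyticAt ℝ G x → dirDerivs l (fun y => F y + G y) x = dirDerivs l F x + dirDerivs l G x := by
  induction l with
  | nil => exact fun _ _ => rfl
  | cons v l ih =>
    intro F G x hF hG
    have h : (fun y => fderiv ℝ (fun z => F z + G z) y v) =ᶠ[𝓝 x]
        fun y => fderiv ℝ F y v + fderiv ℝ G y v := by
      filter_upwards [hF.eventually_analyticAt, hG.eventually_analyticAt] with y h1 h2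
      rw [fderiv_fun_add h1.differentiableAt h2.differentiableAt]
      rfl
    exact (dirDerivs_congr l h).eq_of_nhds.trans
      (ih (analyticAt_fderiv_apply hF v) (analyticAt_fderiv_apply hG v))

theorem dirDerivs_const (l : List V) (hl : l ≠ []) (c : ℂ) (x : V) :
    dirDerivs l (fun _ => c) x = 0 := by
  have h0 : ∀ l : List V, dirDerivs l (fun _ : V => (0 : ℂ)) = fun _ => 0 := by
    intro l
    induction l with
    | nil => rfl
    | cons v l ih => simpa [dirDerivs] using ih
  cases l with
  | nil => exact absurd rfl hl
  | cons v l => simp [dirDerivs, h0]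

theorem dirDerivs_neg (l : List V) : ∀ (F : V → ℂ) (x : V),
    dirDerivs l (fun y => -F y) x = -dirDerivs l F x := by
  induction l with
  | nil => exact fun _ _ => rfl
  | cons v l ih =>
    intro F x
    simpa [dirDerivs, fderiv_fun_neg] using ih (fun y => fderiv ℝ F y v) x

theorem dirDerivs_sum {ι : Type*} (l : List V) (s : Finset ι) {F : ι → V → ℂ} {x : V}
    (hF : ∀ i ∈ s, AnalyticAt ℝ (F i) x) :
    dirDerivs l (fun y => ∑ i ∈ s, F i y) x = ∑ i ∈ s, dirDerivs l (F i) x := by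
  classical
  induction s using Finset.induction_on with
  | empty =>
    simp only [Finset.sum_empty]
    cases l with
    | nil => rfl
    | cons v l => exact dirDerivs_const _ (by simp) 0 x
  | insert i s hi ih =>
    simp only [Finset.sum_insert hi]
    rw [dirDerivs_add l (hF i (by simp))
      (Finset.analyticAt_fun_sum s fun j hj => hF j (by simp [hj])),
      ih fun j hj => hF j (by simp [hj])]

/-- The Leibniz rule, as an estimate. -/
theorem norm_dirDerivs_mul_le (l : List V) : ∀ {F G : V → ℂ} {x : V} {C : ℝ},
    AnalyticAt ℝ F x → AnalyticAt ℝ G x →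
    (∀ l₁ l₂ : List V, (l₁ ++ l₂).Perm l → ‖dirDerivs l₁ F x‖ * ‖dirDerivs l₂ G x‖ ≤ C) →
    ‖dirDerivs l (fun y => F y * G y) x‖ ≤ 2 ^ l.length * C := by
  induction l with
  | nil =>
    intro F G x C _ _ h
    simpa [dirDerivs] using h [] [] (by simp)
  | cons v l ih =>
    intro F G x C hF hG h
    have e : (fun y => fderiv ℝ (fun z => F z * G z) y v) =ᶠ[𝓝 x]
        fun y => fderiv ℝ F y v * G y + F y * fderiv ℝ G y v := by
      filter_upwards [hF.eventually_analyticAt, hG.eventually_analyticAt] with y h1 h2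
      rw [fderiv_fun_mul h1.differentiableAt h2.differentiableAt]
      simp only [add_apply, smul_apply, smul_eq_mul]
      ring
    have hF' := analyticAt_fderiv_apply hF v
    have hG' := analyticAt_fderiv_apply hG v
    have e2 : dirDerivs (v :: l) (fun y => F y * G y) x = _ :=
      (dirDerivs_congr l e).eq_of_nhds.trans (dirDerivs_add l (hF'.mul hG) (hF.mul hG'))
    rw [e2]
    have b1 := ih (C := C) hF' hG fun l₁ l₂ hp => h (v :: l₁) l₂ (by simpa using hp.cons v)
    have b2 := ih (C := C) hF hG' fun l₁ l₂ hp => h l₁ (v :: l₂)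
      (List.perm_middle.trans (hp.cons v))
    refine (norm_add_le _ _).trans ((add_le_add b1 b2).trans (le_of_eq ?_))
    rw [List.length_cons]
    ring

/-- Adjacent transpositions suffice, and they are the symmetry of the second derivative. This is the
symmetry of joint cumulants. -/
theorem dirDerivs_perm {l l' : List V} (h : l.Perm l') : ∀ {F : V → ℂ} {x : V},
    AnalyticAt ℝ F x → dirDerivs l F x = dirDerivs l' F x := by
  induction h with
  | nil => exact fun _ => rfl
  | cons v _ ih => exact fun hF => ih (analyticAt_fderiv_apply hF v)
  | trans _ _ ih1 ih2 => exact fun hF => (ih1 hF).trans (ih2 hF)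
  | swap v w l =>
    intro F x hF
    refine (dirDerivs_congr l ?_).eq_of_nhds
    filter_upwards [hF.eventually_analyticAt] with y hy
    have hs : IsSymmSndFDerivAt ℝ F y := hy.contDiffAt.isSymmSndFDerivAt (n := ⊤) (by simp)
    have hd : DifferentiableAt ℝ (fderiv ℝ F) y := hy.fderiv.differentiableAt
    have key : ∀ a b : V, fderiv ℝ (fun z => fderiv ℝ F z a) y b = fderiv ℝ (fderiv ℝ F) y b a := by
      intro a b
      rw [fderiv_clm_apply hd (differentiableAt_const a)]
      simp
    rw [key, key]
    exact hs v w

theorem dirDerivs_comp_clm (L : W →L[ℝ] V) (l : List W) : ∀ {F : V → ℂ} {x : W},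
    AnalyticAt ℝ F (L x) →
    dirDerivs l (fun y => F (L y)) x = dirDerivs (l.map L) F (L x) := by
  induction l with
  | nil => exact fun _ => rfl
  | cons v l ih =>
    intro F x hF
    have e : (fun y => fderiv ℝ (fun z => F (L z)) y v) =ᶠ[𝓝 x]
        fun y => fderiv ℝ F (L y) (L v) := by
      filter_upwards [L.continuous.continuousAt.eventually hF.eventually_analyticAt] with y hy
      have := fderiv_comp (𝕜 := ℝ) y hy.differentiableAt L.differentiableAt
      have h2 : (fun z => F (L z)) = F ∘ L := rfl
      rw [h2, this]
      simp
    exact (dirDerivs_congr l e).eq_of_nhds.trans (ih (analyticAt_fderiv_apply hF (L v)))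

theorem iteratedFDeriv_apply_eq_dirDerivs {N : ℕ} : ∀ {F : V → ℂ} {x : V}, AnalyticAt ℝ F x →
    ∀ m : Fin N → V, iteratedFDeriv ℝ N F x m = dirDerivs (List.ofFn m) F x := by
  induction N with
  | zero =>
    intro F x _ m
    simp [dirDerivs]
  | succ N ih =>
    intro F x hF m
    have hd : DifferentiableAt ℝ (iteratedFDeriv ℝ N F) x :=
      hF.contDiffAt.differentiableAt_iteratedFDeriv (n := ⊤) (by simp)
    have e : (fun y => iteratedFDeriv ℝ N F y (Fin.tail m)) =ᶠ[𝓝 x]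
        dirDerivs (List.ofFn (Fin.tail m)) F := by
      filter_upwards [hF.eventually_analyticAt] with y hy using ih hy _
    have h1 : fderiv ℝ (fun y => iteratedFDeriv ℝ N F y (Fin.tail m)) x (m 0) =
        fderiv ℝ (iteratedFDeriv ℝ N F) x (m 0) (Fin.tail m) := by
      have := ((ContinuousMultilinearMap.apply ℝ (fun _ : Fin N => V) ℂ
        (Fin.tail m)).hasFDerivAt.comp x hd.hasFDerivAt).fderiv
      have h2 : (fun y => iteratedFDeriv ℝ N F y (Fin.tail m)) =
        (ContinuousMultilinearMap.apply ℝ (fun _ : Fin N => V) ℂ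
        (Fin.tail m)) ∘ iteratedFDeriv ℝ N F := rfl
      rw [h2, this]
      rfl
    rw [iteratedFDeriv_succ_apply_left, ← h1, e.fderiv_eq]
    have h3 := congrFun (dirDerivs_append_singleton (List.ofFn (Fin.tail m)) (m 0) F) x
    refine h3.symm.trans (dirDerivs_perm ?_ hF)
    rw [List.ofFn_succ]
    exact List.perm_append_comm

end DirectionalDerivatives

/-! ### Cumulants as derivatives of `log 𝔼 exp f` on the space of all random variables `f`. -/

section CumulantGeneratingFunction

variable {Ω : Type*} [Fintype Ω]

/-- The average of `X * exp f` over a finite probability space with the uniform measure. -/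
noncomputable def expMean (X f : Ω → ℂ) : ℂ :=
  (Fintype.card Ω : ℂ)⁻¹ * ∑ ω, X ω * Complex.exp (f ω)

/-- The cumulant generating function `f ↦ log 𝔼 exp f` of the uniform measure. -/
noncomputable def logMgf (f : Ω → ℂ) : ℂ := Complex.log (expMean 1 f)

/-- The mean of `X` under the measure with density proportional to `exp f`. -/
noncomputable def tiltedMean (X f : Ω → ℂ) : ℂ := expMean X f / expMean 1 f

/-- The joint cumulant of a list of random variables. -/
noncomputable def listCumulant (l : List (Ω → ℂ)) : ℂ := dirDerivs l logMgf 0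

theorem analyticAt_expMean (X f : Ω → ℂ) : AnalyticAt ℝ (expMean X) f := by
  have hev : ∀ ω : Ω, AnalyticAt ℝ (fun f : Ω → ℂ => f ω) f := fun ω =>
    (ContinuousLinearMap.proj (R := ℝ) (φ := fun _ : Ω => ℂ) ω).analyticAt f
  have hexp : ∀ ω : Ω, AnalyticAt ℝ (fun f : Ω → ℂ => Complex.exp (f ω)) f := fun ω =>
    (analyticAt_cexp.restrictScalars (𝕜 := ℝ)).comp (hev ω)
  exact analyticAt_const.mul
    (Finset.analyticAt_fun_sum _ fun ω _ => analyticAt_const.mul (hexp ω))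

theorem hasLineDerivAt_expMean (X Y f : Ω → ℂ) :
    HasLineDerivAt ℝ (expMean X) (expMean (X * Y) f) f Y := by
  unfold HasLineDerivAt expMean
  refine HasDerivAt.const_mul _ (HasDerivAt.fun_sum fun ω _ => ?_)
  have h1 : HasDerivAt (fun t : ℝ => f ω + (t : ℂ) * Y ω) (Y ω) 0 := by
    simpa using ((Complex.ofRealCLM.hasDerivAt (x := (0 : ℝ))).mul_const (Y ω)).const_add (f ω)
  have h2 := (h1.cexp).const_mul (X ω)
  have e : (X * Y) ω * Complex.exp (f ω) =
      X ω * (Complex.exp (f ω + ((0 : ℝ) : ℂ) * Y ω) * Y ω) := by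
    simp only [Pi.mul_apply, Complex.ofReal_zero, zero_mul, add_zero]
    ring
  have e' : (fun t : ℝ => X ω * Complex.exp ((f + t • Y) ω)) =
      fun t : ℝ => X ω * Complex.exp (f ω + (t : ℂ) * Y ω) := by
    funext t
    simp
  rw [e, e']
  exact h2

theorem expMean_zero_right [Nonempty Ω] : expMean (1 : Ω → ℂ) 0 = 1 := by
  simp [expMean]

theorem eventually_expMean_mem_slitPlane [Nonempty Ω] :
    ∀ᶠ f : Ω → ℂ in 𝓝 0, expMean 1 f ∈ Complex.slitPlane :=
  (analyticAt_expMean 1 0).continuousAt.eventually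
    (Complex.isOpen_slitPlane.mem_nhds (by simp [expMean_zero_right]))

theorem analyticAt_logMgf_of_mem {f : Ω → ℂ} (hf : expMean 1 f ∈ Complex.slitPlane) :
    AnalyticAt ℝ logMgf f :=
  ((analyticAt_clog hf).restrictScalars (𝕜 := ℝ)).comp (analyticAt_expMean 1 f)

theorem analyticAt_logMgf [Nonempty Ω] : AnalyticAt ℝ (logMgf (Ω := Ω)) 0 :=
  analyticAt_logMgf_of_mem (by simp [expMean_zero_right])

theorem analyticAt_tiltedMean [Nonempty Ω] (X : Ω → ℂ) : AnalyticAt ℝ (tiltedMean X) 0 :=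
  (analyticAt_expMean X 0).div (analyticAt_expMean 1 0) (by simp [expMean_zero_right])

/-- Only an equality of germs at 0, where `𝔼 exp f` is near 1 and avoids the branch cut of the
logarithm; germs suffice for derivatives at 0. -/
theorem fderiv_logMgf [Nonempty Ω] (X : Ω → ℂ) :
    (fun f => fderiv ℝ logMgf f X) =ᶠ[𝓝 0] tiltedMean X := by
  filter_upwards [eventually_expMean_mem_slitPlane] with f hf
  have h1 : HasLineDerivAt ℝ logMgf _ f X :=
    (hasLineDerivAt_expMean 1 X f).clog_real (by simpa using hf)
  rw [← (analyticAt_logMgf_of_mem hf).differentiableAt.lineDeriv_eq_fderiv, h1.lineDeriv]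
  simp [tiltedMean]

/-- The quotient rule yields the covariance of `X` and `Y` under the tilted measure. -/
theorem fderiv_tiltedMean [Nonempty Ω] (X Y : Ω → ℂ) :
    (fun f => fderiv ℝ (tiltedMean X) f Y) =ᶠ[𝓝 0]
      fun f => tiltedMean (X * Y) f + -(tiltedMean X f * tiltedMean Y f) := by
  filter_upwards [eventually_expMean_mem_slitPlane] with f hf
  have hne : expMean 1 f ≠ 0 := Complex.slitPlane_ne_zero hf
  have h1 := (hasLineDerivAt_expMean X Y f).fun_div (hasLineDerivAt_expMean 1 Y f)
    (by simpa using hne)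
  have hd : DifferentiableAt ℝ (tiltedMean X) f :=
    ((analyticAt_expMean X f).div (analyticAt_expMean 1 f) hne).differentiableAt
  have h2 : HasLineDerivAt ℝ (tiltedMean X) _ f Y := h1
  rw [← hd.lineDeriv_eq_fderiv, h2.lineDeriv]
  simp only [zero_smul, add_zero, one_mul, tiltedMean]
  field_simp
  ring

theorem listCumulant_cons [Nonempty Ω] (X : Ω → ℂ) (l : List (Ω → ℂ)) :
    listCumulant (X :: l) = dirDerivs l (tiltedMean X) 0 :=
  (dirDerivs_congr l (fderiv_logMgf X)).eq_of_nhds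

theorem listCumulant_perm [Nonempty Ω] {l l' : List (Ω → ℂ)} (h : l.Perm l') :
    listCumulant l = listCumulant l' :=
  dirDerivs_perm h analyticAt_logMgf

/-- Merging two arguments of a joint cumulant into their product. -/
theorem listCumulant_cons_cons [Nonempty Ω] (X Y : Ω → ℂ) (l : List (Ω → ℂ)) :
    listCumulant (X :: Y :: l) = listCumulant (X * Y :: l) -
      dirDerivs l (fun f => tiltedMean X f * tiltedMean Y f) 0 := by
  rw [listCumulant_cons, listCumulant_cons]
  change dirDerivs l (fun f => fderiv ℝ (tiltedMean X) f Y) 0 = _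
  have hm := (analyticAt_tiltedMean X).fun_mul (analyticAt_tiltedMean Y)
  rw [(dirDerivs_congr l (fderiv_tiltedMean X Y)).eq_of_nhds,
    dirDerivs_add l (analyticAt_tiltedMean _) hm.fun_neg, dirDerivs_neg, sub_eq_add_neg]

theorem norm_listCumulant_cons_cons_le [Nonempty Ω] (X Y : Ω → ℂ) (l : List (Ω → ℂ)) {C : ℝ}
    (hC : ∀ l₁ l₂ : List (Ω → ℂ), (l₁ ++ l₂).Perm l →
      ‖listCumulant (X :: l₁)‖ * ‖listCumulant (Y :: l₂)‖ ≤ C) :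
    ‖listCumulant (X :: Y :: l)‖ ≤ ‖listCumulant (X * Y :: l)‖ + 2 ^ l.length * C := by
  rw [listCumulant_cons_cons]
  refine (norm_sub_le _ _).trans (add_le_add le_rfl ?_)
  refine norm_dirDerivs_mul_le l (analyticAt_tiltedMean X) (analyticAt_tiltedMean Y) ?_
  intro l₁ l₂ h
  rw [← listCumulant_cons, ← listCumulant_cons]
  exact hC l₁ l₂ h

theorem listCumulant_sum_cons [Nonempty Ω] {ι : Type*} (s : Finset ι) (X : ι → Ω → ℂ)
    (l : List (Ω → ℂ)) :
    ∑ i ∈ s, listCumulant (X i :: l) = listCumulant ((∑ i ∈ s, X i) :: l) := by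
  simp only [listCumulant, dirDerivs, map_sum]
  rw [dirDerivs_sum]
  exact fun i _ => analyticAt_fderiv_apply analyticAt_logMgf _

/-- The tilted mean of a constant does not depend on the tilt, so any further derivative kills it.
-/
theorem listCumulant_const_cons [Nonempty Ω] (c : ℂ) (l : List (Ω → ℂ)) (hl : l ≠ []) :
    listCumulant ((fun _ => c) :: l) = 0 := by
  rw [listCumulant_cons]
  have h : tiltedMean (fun _ : Ω => c) =ᶠ[𝓝 0] fun _ => c := by
    filter_upwards [eventually_expMean_mem_slitPlane] with f hf
    have hne : expMean 1 f ≠ 0 := Complex.slitPlane_ne_zero hf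
    have : expMean (fun _ : Ω => c) f = c * expMean 1 f := by
      simp only [expMean, Pi.one_apply, one_mul, ← Finset.mul_sum]
      ring
    rw [tiltedMean, this, mul_div_assoc, div_self hne, mul_one]
  rw [(dirDerivs_congr l h).eq_of_nhds, dirDerivs_const l hl]

theorem listCumulant_singleton [Nonempty Ω] (X : Ω → ℂ) :
    listCumulant [X] = (Fintype.card Ω : ℂ)⁻¹ * ∑ ω, X ω := by
  rw [listCumulant_cons]
  simp only [dirDerivs, tiltedMean, expMean_zero_right, div_one]
  simp [expMean]

/-- Joint cumulants are invariant under measure preserving bijections. -/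
theorem listCumulant_map_comp [Nonempty Ω] (e : Equiv.Perm Ω) (l : List (Ω → ℂ)) :
    listCumulant (l.map fun X => X ∘ e) = listCumulant l := by
  let L : (Ω → ℂ) →L[ℝ] (Ω → ℂ) :=
    ContinuousLinearMap.pi fun ω => ContinuousLinearMap.proj (R := ℝ) (e ω)
  have hL : ∀ f, L f = f ∘ e := fun f => rfl
  have h0 : L 0 = 0 := map_zero L
  have h := dirDerivs_comp_clm L l (F := logMgf) (x := 0) (by rw [h0]; exact analyticAt_logMgf)
  have h1 : (fun f => logMgf (L f)) = logMgf (Ω := Ω) := by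
    funext f
    simp only [logMgf, expMean, hL, Pi.one_apply, Function.comp]
    rw [Equiv.sum_comp e (fun ω => 1 * Complex.exp (f ω))]
  rw [h1, h0] at h
  exact h.symm

end CumulantGeneratingFunction

/-! ### Decay of cumulants of functions of the entries of a uniform permutation. -/

section PermutationCumulants

variable {n : ℕ}

/-- The random variable `g (σ j)` of a uniform permutation `σ`. -/
def letterVar (p : Fin n × (Fin n → ℂ)) (s : Equiv.Perm (Fin n)) : ℂ := p.2 (s p.1)

/-- The joint cumulant of random variables of the form `g (σ j)`. -/
noncomputable def permCumulant (l : List (Fin n × (Fin n → ℂ))) : ℂ :=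
  listCumulant (l.map letterVar)

/-- The letters occurring in a list of pairs `(j, g)`. -/
def letters (l : List (Fin n × (Fin n → ℂ))) : Finset (Fin n) := (l.map Prod.fst).toFinset

theorem letters_cons (p : Fin n × (Fin n → ℂ)) (l : List (Fin n × (Fin n → ℂ))) :
    letters (p :: l) = insert p.1 (letters l) := by
  simp [letters]

theorem letters_append (l₁ l₂ : List (Fin n × (Fin n → ℂ))) :
    letters (l₁ ++ l₂) = letters l₁ ∪ letters l₂ := by
  simp [letters]

theorem letters_perm {l l' : List (Fin n × (Fin n → ℂ))} (h : l.Perm l') :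
    letters l = letters l' :=
  List.toFinset_eq_of_perm _ _ (h.map _)

theorem permCumulant_perm {l l' : List (Fin n × (Fin n → ℂ))} (h : l.Perm l') :
    permCumulant l = permCumulant l' :=
  listCumulant_perm (h.map _)

/-- Lifts the Leibniz splittings from lists of random variables back to lists of pairs `(j, g)`,
where letters can be counted. -/
theorem exists_perm_of_perm_map {α β : Type*} (f : α → β) {l : List α} {m : List β}
    (h : m.Perm (l.map f)) : ∃ l' : List α, l'.Perm l ∧ m = l'.map f := by
  induction l generalizing m with
  | nil => exact ⟨[], List.Perm.refl _, by simpa using h⟩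
  | cons a l ih =>
    have ha : f a ∈ m := h.mem_iff.2 (by simp)
    obtain ⟨s, t, rfl⟩ := List.append_of_mem ha
    have h' : (s ++ t).Perm (l.map f) :=
      (List.perm_cons (f a)).1 (List.perm_middle.symm.trans (by simpa using h))
    obtain ⟨l', hl', e⟩ := ih h'
    obtain ⟨l₁, l₂, rfl, rfl, rfl⟩ := List.map_eq_append_iff.1 e.symm
    exact ⟨l₁ ++ a :: l₂, List.perm_middle.trans (hl'.cons a), by simp⟩

theorem norm_permCumulant_cons_cons_le (j : Fin n) (g h : Fin n → ℂ)
    (l : List (Fin n × (Fin n → ℂ))) {C : ℝ}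
    (hC : ∀ l₁ l₂ : List (Fin n × (Fin n → ℂ)), (l₁ ++ l₂).Perm l →
      ‖permCumulant ((j, g) :: l₁)‖ * ‖permCumulant ((j, h) :: l₂)‖ ≤ C) :
    ‖permCumulant ((j, g) :: (j, h) :: l)‖ ≤
      ‖permCumulant ((j, g * h) :: l)‖ + 2 ^ l.length * C := by
  have key := norm_listCumulant_cons_cons_le (letterVar (j, g)) (letterVar (j, h))
    (l.map letterVar) (C := C) ?_
  · simpa [permCumulant, show letterVar (j, g * h) = letterVar (j, g) * letterVar (j, h) from rfl]
      using key
  · intro l₁ l₂ hp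
    obtain ⟨l', hl', e⟩ := exists_perm_of_perm_map _ hp
    obtain ⟨m₁, m₂, rfl, rfl, rfl⟩ := List.map_eq_append_iff.1 e.symm
    exact hC m₁ m₂ hl'

/-- Exchangeability. -/
theorem permCumulant_cons_eq {i j : Fin n} (g : Fin n → ℂ) {l : List (Fin n × (Fin n → ℂ))}
    (hi : i ∉ letters l) (hj : j ∉ letters l) :
    permCumulant ((i, g) :: l) = permCumulant ((j, g) :: l) := by
  -- Right multiplication by the transposition of `i` and `j` preserves the uniform measure and
  -- fixes every variable of `l`.
  rw [permCumulant, ← listCumulant_map_comp (Equiv.mulRight (Equiv.swap i j)), permCumulant,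
    List.map_map]
  congr 1
  simp only [List.map_cons]
  congr 1
  · funext s
    simp [letterVar]
  · refine List.map_congr_left fun p hp => ?_
    have hmem : p.1 ∈ letters l := by
      simp only [letters, List.mem_toFinset]
      exact List.mem_map_of_mem hp
    funext s
    simp only [Function.comp, letterVar, Equiv.coe_mulRight, Equiv.Perm.mul_apply]
    rw [Equiv.swap_apply_of_ne_of_ne (fun h : p.1 = i => hi (h ▸ hmem)) fun h : p.1 = j => hj (h ▸ hmem)]

/-- The sum of `g (σ i)` over all letters `i` is deterministic. -/
theorem sum_permCumulant_cons (g : Fin n → ℂ) {l : List (Fin n × (Fin n → ℂ))} (hl : l ≠ []) :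
    ∑ i, permCumulant ((i, g) :: l) = 0 := by
  simp only [permCumulant, List.map_cons]
  rw [listCumulant_sum_cons]
  have h : ∑ i, letterVar (i, g) = fun _ : Equiv.Perm (Fin n) => ∑ q, g q := by
    funext s
    simp only [Finset.sum_apply, letterVar]
    exact Equiv.sum_comp s g
  rw [h]
  exact listCumulant_const_cons _ _ (by simpa using hl)

theorem norm_permCumulant_singleton_le (p : Fin n × (Fin n → ℂ)) {C : ℝ}
    (hC : ∀ q, ‖p.2 q‖ ≤ C) : ‖permCumulant [p]‖ ≤ C := by
  rw [permCumulant, List.map_singleton, listCumulant_singleton, norm_mul, norm_inv,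
    Complex.norm_natCast]
  have hpos : (0 : ℝ) < Fintype.card (Equiv.Perm (Fin n)) := by
    exact_mod_cast Fintype.card_pos
  rw [inv_mul_le_iff₀ hpos]
  refine (norm_sum_le _ _).trans ((Finset.sum_le_sum fun s _ => hC (s p.1)).trans ?_)
  simp

/-- Splitting off a repeated letter leaves only lists of length at most `N + 1`, to which `ih`
applies. The bound `max C (C * C)` admits the merged function `g * h`. -/
theorem norm_permCumulant_repeated_le {N n : ℕ} {C K : ℝ} (hK : 0 ≤ K)
    (ih : ∀ l : List (Fin n × (Fin n → ℂ)), l ≠ [] → l.length ≤ N + 1 →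
      (∀ p ∈ l, ∀ q, ‖p.2 q‖ ≤ max C (C * C)) →
      ‖permCumulant l‖ * (n : ℝ) ^ (#(letters l) - 1) ≤ K)
    (l : List (Fin n × (Fin n → ℂ))) (hlen : l.length ≤ N + 2)
    (hC : ∀ p ∈ l, ∀ q, ‖p.2 q‖ ≤ C) (hdup : ¬ (l.map Prod.fst).Nodup) :
    ‖permCumulant l‖ * (n : ℝ) ^ (#(letters l) - 1) ≤ K + 2 ^ N * (K * K) := by
  obtain ⟨j, g, h, m, hm⟩ : ∃ j g h m, l.Perm ((j, g) :: (j, h) :: m) := by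
    obtain ⟨j, hj⟩ := List.exists_duplicate_iff_not_nodup.2 hdup
    obtain ⟨t, ht⟩ := (List.duplicate_iff_sublist.1 hj).exists_perm_append
    obtain ⟨l', hl', e⟩ := exists_perm_of_perm_map _ ht.symm
    match l', e, hl' with
    | [], e, _ => simp at e
    | [a], e, _ => simp at e
    | (a, g) :: (b, h) :: m, e, hl' =>
      simp only [List.cons_append, List.nil_append, List.map_cons, List.cons.injEq] at e
      obtain ⟨rfl, rfl, _⟩ := e
      exact ⟨_, g, h, m, hl'.symm⟩
  rw [permCumulant_perm hm, letters_perm hm]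
  have hlen' : m.length ≤ N := by
    have := hm.length_eq
    simp only [List.length_cons] at this
    omega
  have hC' : ∀ p ∈ (j, g) :: (j, h) :: m, ∀ q, ‖p.2 q‖ ≤ C :=
    fun p hp => hC p (hm.mem_iff.2 hp)
  have hg := hC' (j, g) (by simp)
  have hh := hC' (j, h) (by simp)
  have hm' : ∀ p ∈ m, ∀ q, ‖p.2 q‖ ≤ max C (C * C) := fun p hp q =>
    (hC' p (by simp [hp]) q).trans (le_max_left _ _)
  have hn : (1 : ℝ) ≤ n := by exact_mod_cast (Nat.one_le_iff_ne_zero.2 fun h0 => by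
    subst h0; exact j.elim0)
  have hlet : letters ((j, g) :: (j, h) :: m) = insert j (letters m) := by
    simp [letters_cons]
  rw [hlet]
  set r := #(insert j (letters m)) with hr
  have hpow : (0 : ℝ) < (n : ℝ) ^ (r - 1) := by positivity
  have h1 := ih ((j, g * h) :: m) (by simp) (by simpa using hlen') (by
    intro p hp
    rcases List.mem_cons.1 hp with rfl | hp
    · intro q
      refine le_trans ?_ (le_max_right _ _)
      simp only [Pi.mul_apply, norm_mul]
      exact mul_le_mul (hg q) (hh q) (norm_nonneg _) ((norm_nonneg _).trans (hg q))
    · exact hm' p hp)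
  rw [letters_cons] at h1
  have h2 := norm_permCumulant_cons_cons_le j g h m (C := K * K / (n : ℝ) ^ (r - 1)) (by
    intro l₁ l₂ hp
    have hlens := hp.length_eq
    rw [List.length_append] at hlens
    have a1 := ih ((j, g) :: l₁) (by simp) (by simp only [List.length_cons]; omega) (by
      intro p hp'
      rcases List.mem_cons.1 hp' with rfl | hp'
      · exact fun q => (hg q).trans (le_max_left _ _)
      · exact hm' p (hp.mem_iff.1 (List.mem_append_left _ hp')))
    have a2 := ih ((j, h) :: l₂) (by simp) (by simp only [List.length_cons]; omega) (by
      intro p hp'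
      rcases List.mem_cons.1 hp' with rfl | hp'
      · exact fun q => (hh q).trans (le_max_left _ _)
      · exact hm' p (hp.mem_iff.1 (List.mem_append_right _ hp')))
    rw [letters_cons] at a1 a2
    simp only at a1 a2
    rw [le_div_iff₀ hpow]
    -- The two letter sets cover all `r` letters and meet at least in `j`.
    have hcard : r - 1 ≤ (#(insert j (letters l₁)) - 1) + (#(insert j (letters l₂)) - 1) := by
      have hu : insert j (letters m) = insert j (letters l₁) ∪ insert j (letters l₂) := by
        rw [← letters_perm hp, letters_append]
        ext x
        simp only [mem_insert, mem_union]
        tauto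
      have hi : 0 < #(insert j (letters l₁) ∩ insert j (letters l₂)) :=
        card_pos.2 ⟨j, by simp⟩
      have := card_union_add_card_inter (insert j (letters l₁)) (insert j (letters l₂))
      rw [← hu] at this
      omega
    calc _ ≤ ‖permCumulant ((j, g) :: l₁)‖ * ‖permCumulant ((j, h) :: l₂)‖ *
          (n : ℝ) ^ ((#(insert j (letters l₁)) - 1) + (#(insert j (letters l₂)) - 1)) := by
          gcongr
      _ = (‖permCumulant ((j, g) :: l₁)‖ * (n : ℝ) ^ (#(insert j (letters l₁)) - 1)) *
          (‖permCumulant ((j, h) :: l₂)‖ * (n : ℝ) ^ (#(insert j (letters l₂)) - 1)) := by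
          rw [pow_add]; ring
      _ ≤ K * K := by gcongr)
  calc _ ≤ (‖permCumulant ((j, g * h) :: m)‖ +
        2 ^ m.length * (K * K / (n : ℝ) ^ (r - 1))) * (n : ℝ) ^ (r - 1) := by gcongr
    _ = ‖permCumulant ((j, g * h) :: m)‖ * (n : ℝ) ^ (r - 1) + 2 ^ m.length * (K * K) := by
        field_simp
    _ ≤ K + 2 ^ N * (K * K) := by
        gcongr
        exact one_le_two

/-- Solves the vanishing sum over the first letter for its `n - M` equal terms, `M` being the length
of `l`. The `M` remaining terms repeat a letter of `l` and have one letter fewer; dividing by `n -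
M` restores the missing power of `n`. -/
theorem norm_permCumulant_nodup_le {N n : ℕ} {K : ℝ} (p : Fin n × (Fin n → ℂ))
    (l : List (Fin n × (Fin n → ℂ))) (hl : l ≠ []) (hlen : l.length ≤ N + 1)
    (hnd : ((p :: l).map Prod.fst).Nodup)
    (h : ∀ i ∈ letters l,
      ‖permCumulant ((i, p.2) :: l)‖ * (n : ℝ) ^ (#(letters ((i, p.2) :: l)) - 1) ≤ K) :
    ‖permCumulant (p :: l)‖ * (n : ℝ) ^ (#(letters (p :: l)) - 1) ≤
      ((N : ℝ) + 2) * ((N + 1) * K) := by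
  obtain ⟨j, g⟩ := p
  simp only [List.map_cons, List.nodup_cons] at hnd
  have hj : j ∉ letters l := by simpa only [letters, List.mem_toFinset] using hnd.1
  have hcard : #(letters l) = l.length := by
    rw [letters, List.toFinset_card_of_nodup hnd.2, List.length_map]
  have hpos : 0 < l.length := List.length_pos_iff.2 hl
  rw [letters_cons, card_insert_of_notMem hj, Nat.add_sub_cancel, hcard]
  have hle : l.length + 1 ≤ n := by
    have := card_le_univ (insert j (letters l))
    rwa [card_insert_of_notMem hj, hcard, Fintype.card_fin] at this
  obtain ⟨M, hM⟩ : ∃ M, l.length = M := ⟨_, rfl⟩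
  rw [hM] at hcard hpos hle hlen ⊢
  have hsum := sum_permCumulant_cons g hl
  rw [← Finset.sum_add_sum_compl (letters l)] at hsum
  have hc : ∑ i ∈ (letters l)ᶜ, permCumulant ((i, g) :: l) =
      ((n - M : ℕ) : ℂ) * permCumulant ((j, g) :: l) := by
    rw [Finset.sum_congr rfl fun i hi => permCumulant_cons_eq g (mem_compl.1 hi) hj]
    rw [sum_const, card_compl, Fintype.card_fin, hcard, nsmul_eq_mul]
  rw [hc] at hsum
  have hnorm : ((n - M : ℕ) : ℝ) * ‖permCumulant ((j, g) :: l)‖ ≤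
      ∑ i ∈ letters l, ‖permCumulant ((i, g) :: l)‖ := by
    rw [← Complex.norm_natCast, ← norm_mul, eq_neg_of_add_eq_zero_right hsum, norm_neg]
    exact norm_sum_le _ _
  have hK : ∑ i ∈ letters l, ‖permCumulant ((i, g) :: l)‖ * (n : ℝ) ^ (M - 1) ≤ M * K := by
    refine (Finset.sum_le_card_nsmul _ _ K fun i hi => ?_).trans (by rw [hcard, nsmul_eq_mul])
    have := h i hi
    rwa [letters_cons, insert_eq_of_mem hi, hcard] at this
  rw [← Finset.sum_mul] at hK
  obtain ⟨i, hi⟩ : (letters l).Nonempty := card_pos.1 (by omega)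
  have hK0 : 0 ≤ K := le_trans (by positivity) (h i hi)
  -- With `n = M + 1 + d` this reads `M + 1 + d ≤ (M + 1) * (d + 1)`, so no largeness of `n` is
  -- needed.
  have hnM : (n : ℝ) ≤ (M + 1) * ((n - M : ℕ) : ℝ) := by
    obtain ⟨d, rfl⟩ := Nat.exists_eq_add_of_le hle
    have : M + 1 + d - M = d + 1 := by omega
    rw [this]
    push_cast
    nlinarith [mul_nonneg (Nat.cast_nonneg (α := ℝ) M) (Nat.cast_nonneg (α := ℝ) d)]
  have hMN : (M : ℝ) ≤ N + 1 := by exact_mod_cast hlen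
  have hsplit : (n : ℝ) ^ M = n * (n : ℝ) ^ (M - 1) := by
    rw [← pow_succ', Nat.sub_add_cancel hpos]
  calc ‖permCumulant ((j, g) :: l)‖ * (n : ℝ) ^ M
      = (n * ‖permCumulant ((j, g) :: l)‖) * (n : ℝ) ^ (M - 1) := by rw [hsplit]; ring
    _ ≤ ((M + 1) * ((n - M : ℕ) : ℝ) * ‖permCumulant ((j, g) :: l)‖) * (n : ℝ) ^ (M - 1) := by
        gcongr
    _ = (M + 1) * ((((n - M : ℕ) : ℝ) * ‖permCumulant ((j, g) :: l)‖) * (n : ℝ) ^ (M - 1)) := by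
        ring
    _ ≤ (M + 1) * ((∑ i ∈ letters l, ‖permCumulant ((i, g) :: l)‖) * (n : ℝ) ^ (M - 1)) := by
        gcongr
    _ ≤ (M + 1) * (M * K) := by gcongr
    _ ≤ ((N : ℝ) + 2) * ((N + 1) * K) := by
        gcongr ?_ * (?_ * K)
        linarith

/-- A joint cumulant of bounded functions of `r` distinct entries of a uniform permutation of
`n` elements is `O(n ^ (1 - r))`. -/
theorem exists_norm_permCumulant_le (N : ℕ) : ∀ C : ℝ, ∃ K : ℝ, 0 ≤ K ∧
    ∀ (n : ℕ) (l : List (Fin n × (Fin n → ℂ))), l ≠ [] → l.length ≤ N + 1 →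
      (∀ p ∈ l, ∀ q, ‖p.2 q‖ ≤ C) →
      ‖permCumulant l‖ * (n : ℝ) ^ (#(letters l) - 1) ≤ K := by
  induction N with
  | zero =>
    refine fun C => ⟨max C 0, le_max_right _ _, fun n l hl hlen hC => ?_⟩
    obtain ⟨p, rfl⟩ := List.length_eq_one_iff.1
      (le_antisymm hlen (List.length_pos_iff.2 hl))
    have : #(letters [p]) - 1 = 0 := by simp [letters]
    rw [this, pow_zero, mul_one]
    exact (norm_permCumulant_singleton_le p (hC p (by simp))).trans (le_max_left _ _)
  | succ N ih =>
    intro C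
    obtain ⟨K, hK, ihK⟩ := ih (max C (C * C))
    have hA : 0 ≤ K + 2 ^ N * (K * K) := by positivity
    have hA' : K + 2 ^ N * (K * K) ≤ ((N : ℝ) + 2) * ((N + 1) * (K + 2 ^ N * (K * K))) := by
      have h1 : (1 : ℝ) ≤ ((N : ℝ) + 2) * (N + 1) := by
        nlinarith [Nat.cast_nonneg (α := ℝ) N]
      nlinarith [mul_le_mul_of_nonneg_right h1 hA]
    refine ⟨((N : ℝ) + 2) * ((N + 1) * (K + 2 ^ N * (K * K))), by positivity,
      fun n l hl hlen hC => ?_⟩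
    by_cases hnd : (l.map Prod.fst).Nodup
    · match l, hl, hlen, hC, hnd with
      -- The vanishing sum needs order at least two, so a mean is bounded directly.
      | [p], _, _, hC, _ =>
        refine (ihK n [p] (by simp) (by simp) fun p' hp q =>
          (hC p' hp q).trans (le_max_left _ _)).trans (le_trans ?_ hA')
        exact le_add_of_nonneg_right (by positivity)
      | p :: p' :: l, _, hlen, hC, hnd =>
        refine norm_permCumulant_nodup_le p (p' :: l) (by simp)
          (by simpa using hlen) hnd fun i hi => ?_
        refine norm_permCumulant_repeated_le hK (ihK n) _ hlen ?_ ?_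
        · intro x hx
          rcases List.mem_cons.1 hx with rfl | hx
          · exact hC p (by simp)
          · exact hC x (by simp [hx])
        · intro hnd'
          rw [List.map_cons, List.nodup_cons] at hnd'
          exact hnd'.1 (by simpa only [letters, List.mem_toFinset] using hi)
    · exact (norm_permCumulant_repeated_le hK (ihK n) l hlen hC hnd).trans hA'

end PermutationCumulants

/-! ### Specialization to the normalized ranks. -/

section RankCumulants

theorem logCharFun_uniformPerm {n N : ℕ} (ξ : Fin N → Equiv.Perm (Fin n) → ℝ) (x : Fin N → ℝ) :
    logCharFun (uniformPerm n) ξ x =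
      logMgf (∑ i, x i • fun s => Complex.I * (ξ i s : ℂ)) := by
  rw [logCharFun, logMgf, expMean, uniformPerm, PMF.integral_eq_sum]
  congr 1
  rw [Finset.mul_sum]
  refine Finset.sum_congr rfl fun s _ => ?_
  rw [PMF.uniformOfFintype_apply]
  simp only [ENNReal.toReal_inv, ENNReal.toReal_natCast, Pi.one_apply, one_mul,
    Finset.sum_apply, Pi.smul_apply, Complex.real_smul, Complex.ofReal_inv, Complex.ofReal_natCast]
  congr 3
  funext i
  ring

/-- `logCharFun` is `logMgf` composed with a linear map that sends the `i`-th basis vector to `I * ξ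
i`. -/
theorem jointCumulant_uniformPerm {n N : ℕ} (ξ : Fin N → Equiv.Perm (Fin n) → ℝ) :
    jointCumulant (uniformPerm n) ξ = (Complex.I ^ N)⁻¹ *
      listCumulant (List.ofFn fun i => fun s => Complex.I * (ξ i s : ℂ)) := by
  let L : (Fin N → ℝ) →L[ℝ] (Equiv.Perm (Fin n) → ℂ) :=
    ∑ i, (ContinuousLinearMap.proj (R := ℝ) (φ := fun _ : Fin N => ℝ) i).smulRight
      fun s => Complex.I * (ξ i s : ℂ)
  have hL : ∀ x, L x = ∑ i, x i • fun s => Complex.I * (ξ i s : ℂ) := fun x => by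
    simp [L]
  have hF : logCharFun (uniformPerm n) ξ = fun x => logMgf (L x) := by
    funext x
    rw [logCharFun_uniformPerm, hL]
  have han : AnalyticAt ℝ logMgf (L 0) := by
    rw [map_zero]
    exact analyticAt_logMgf
  have han' : AnalyticAt ℝ (fun x => logMgf (L x)) 0 := han.comp (L.analyticAt 0)
  rw [jointCumulant, hF, iteratedFDeriv_apply_eq_dirDerivs han', dirDerivs_comp_clm L _ han,
    map_zero, listCumulant, List.map_ofFn]
  congr 3
  funext i
  simp only [Function.comp, hL]
  rw [Finset.sum_eq_single i (fun b _ hb => by rw [Pi.single_eq_of_ne hb, zero_smul]) (by simp),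
    Pi.single_eq_same, one_smul]

/-- The normalized rank times `i`, as a function of the letter. -/
noncomputable def rankFun (n : ℕ) (q : Fin n) : ℂ :=
  Complex.I * ((Real.sqrt (12 / ((n : ℝ) ^ 2 - 1)) *
    (((q : ℕ) + 1 : ℕ) - ((n : ℝ) + 1) / 2) : ℝ) : ℂ)

theorem norm_rankFun_le (n : ℕ) (q : Fin n) : ‖rankFun n q‖ ≤ 2 := by
  rw [rankFun, norm_mul, Complex.norm_I, one_mul, Complex.norm_real, Real.norm_eq_abs]
  refine abs_le_of_sq_le_sq ?_ (by norm_num)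
  have hq : (q : ℝ) + 1 ≤ n := by exact_mod_cast q.isLt
  have hq0 : (0 : ℝ) ≤ (q : ℝ) := Nat.cast_nonneg _
  have hsq : ((n : ℝ) ^ 2 - 1) ≥ 0 := by nlinarith
  rw [mul_pow, Real.sq_sqrt (by positivity)]
  rcases hsq.eq_or_lt with h0 | h0
  -- For `n = 1` the normalization is `12 / 0 = 0`.
  · rw [← h0]; norm_num
  · rw [div_mul_eq_mul_div, div_le_iff₀ h0]
    push_cast
    nlinarith [mul_nonneg hq0 (sub_nonneg.2 hq)]

theorem jointCumulant_rankZ {n N : ℕ} (f : Fin N → Fin n) :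
    jointCumulant (uniformPerm n) (fun i => rankZ n (f i)) = (Complex.I ^ N)⁻¹ *
      permCumulant (List.ofFn fun i => (f i, rankFun n)) := by
  rw [jointCumulant_uniformPerm, permCumulant, List.map_ofFn]
  rfl

theorem exists_norm_wordCumulant_le {α : Type*} [LinearOrder α] (B : Finset α) :
    ∃ K : ℝ, 0 ≤ K ∧ ∀ (n : ℕ) (j : {a // a ∈ B} → Fin n) (A : Finset α), A ⊆ B → A.Nonempty →
      ‖wordCumulant j A‖ * (n : ℝ) ^ (#((A.subtype (· ∈ B)).image j) - 1) ≤ K := by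
  obtain ⟨K, hK, h⟩ := exists_norm_permCumulant_le #B 2
  refine ⟨K, hK, fun n j A hA hne => ?_⟩
  have hcard : #(A.subtype (· ∈ B)) = #A := by
    rw [card_subtype, filter_true_of_mem fun a ha => hA ha]
  have hpos := card_pos.2 hne
  have hle := card_le_card hA
  set S := A.subtype (· ∈ B) with hS
  have := h n (List.ofFn fun i : Fin #S => (j (S.orderEmbOfFin rfl i), rankFun n))
    (by rw [← List.length_pos_iff, List.length_ofFn]; omega) (by rw [List.length_ofFn]; omega)
    (by
      intro p hp q
      obtain ⟨i, rfl⟩ := (List.mem_ofFn' _ _).1 hp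
      exact norm_rankFun_le n q)
  have hlet : letters (List.ofFn fun i : Fin #S => (j (S.orderEmbOfFin rfl i), rankFun n)) =
      S.image j := by
    ext q
    simp only [letters, List.map_ofFn, List.mem_toFinset, List.mem_ofFn', Set.mem_range,
      Function.comp, mem_image]
    constructor
    · rintro ⟨i, rfl⟩
      exact ⟨_, S.orderEmbOfFin_mem rfl i, rfl⟩
    · rintro ⟨a, ha, rfl⟩
      have : a ∈ Set.range (S.orderEmbOfFin rfl) := by
        rw [range_orderEmbOfFin]; exact ha
      obtain ⟨i, rfl⟩ := this
      exact ⟨i, rfl⟩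
  rw [hlet] at this
  rw [wordCumulant, jointCumulantOn, jointCumulant_rankZ, norm_mul, norm_inv, norm_pow,
    Complex.norm_I, one_pow, inv_one, one_mul]
  exact this

end RankCumulants

/-! ### Counting words by their number of distinct letters. -/

section Words

/-- The number of words with `r` distinct letters, out of `n`, is `O(n ^ r)`. -/
theorem sum_inv_pow_card_image_fin_le (m : ℕ) {n : ℕ} (hn : 0 < n) :
    ∑ j : Fin m → Fin n, ((n : ℝ)⁻¹) ^ #(univ.image j) ≤ m.factorial := by
  have hn' : (0 : ℝ) < n := by exact_mod_cast hn
  induction m with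
  | zero => simp
  | succ m ih =>
    rw [← (Fin.consEquiv fun _ : Fin (m + 1) => Fin n).sum_comp, Fintype.sum_prod_type_right]
    have himg : ∀ (a : Fin n) (j : Fin m → Fin n),
        univ.image (Fin.consEquiv (fun _ : Fin (m + 1) => Fin n) (a, j)) =
          insert a (univ.image j) := by
      intro a j
      ext x
      simp [Fin.exists_fin_succ, eq_comm]
    -- A first letter already in `j` has at most `m` choices of unchanged weight; a new one has at
    -- most `n` choices, each costing `1/n`. Hence the factor `m + 1`, and `m!` overall.
    have hstep : ∀ j : Fin m → Fin n,
        ∑ a, ((n : ℝ)⁻¹) ^ #(univ.image (Fin.consEquiv (fun _ : Fin (m + 1) => Fin n) (a, j))) ≤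
          (m + 1) * ((n : ℝ)⁻¹) ^ #(univ.image j) := by
      intro j
      have hm : #(univ.image j) ≤ m := card_image_le.trans (by simp)
      rw [← Finset.sum_add_sum_compl (univ.image j), add_mul, one_mul]
      refine add_le_add ?_ ?_
      · rw [Finset.sum_congr rfl fun a ha => by rw [himg, insert_eq_of_mem ha],
          sum_const, nsmul_eq_mul]
        gcongr
      · rw [Finset.sum_congr rfl fun a ha => by
          rw [himg, card_insert_of_notMem (mem_compl.1 ha)], sum_const, nsmul_eq_mul, pow_succ']
        have h1 : (#(univ.image j)ᶜ : ℝ) ≤ n := by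
          exact_mod_cast (card_le_univ _).trans (by simp)
        calc _ ≤ (n : ℝ) * ((n : ℝ)⁻¹ * ((n : ℝ)⁻¹) ^ #(univ.image j)) := by gcongr
          _ = _ := by field_simp
    refine (Finset.sum_le_sum fun j _ => hstep j).trans ?_
    rw [← Finset.mul_sum, Nat.factorial_succ]
    push_cast
    gcongr

theorem sum_inv_pow_card_image_le {W : Type*} [Fintype W] [DecidableEq W] {n : ℕ} (hn : 0 < n) :
    ∑ j : W → Fin n, ((n : ℝ)⁻¹) ^ #(univ.image j) ≤ (Fintype.card W).factorial := by
  refine le_trans (le_of_eq ?_) (sum_inv_pow_card_image_fin_le (Fintype.card W) hn)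
  rw [← ((Fintype.equivFin W).arrowCongr (Equiv.refl (Fin n))).sum_comp]
  refine Finset.sum_congr rfl fun j _ => ?_
  congr 2
  ext x
  simp only [mem_image, mem_univ, true_and, Equiv.arrowCongr_apply, Equiv.coe_refl,
    Function.comp, id]
  exact ((Fintype.equivFin W).symm.exists_congr_right (q := fun a => j a = x)).symm

end Words

/-! ### Connectedness of the blocks of `π` within a block of the join. -/

section Connectivity

variable {α : Type*} [Fintype α] [DecidableEq α]

theorem subset_of_mem_join_left {π ρ : Finpartition (univ : Finset α)} {A B : Finset α}
    (hA : A ∈ π.parts) (hB : B ∈ (join π ρ).parts) {a : α} (ha : a ∈ A) (haB : a ∈ B) :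
    A ⊆ B := by
  obtain ⟨D, hD, hAD⟩ := (isLUB_join π ρ).1 (by simp : π ∈ ({π, ρ} : Set _)) hA
  rwa [(join π ρ).eq_of_mem_parts hD hB (hAD ha) haB] at hAD

theorem subset_of_mem_join_right {π ρ : Finpartition (univ : Finset α)} {A B : Finset α}
    (hA : A ∈ ρ.parts) (hB : B ∈ (join π ρ).parts) {a : α} (ha : a ∈ A) (haB : a ∈ B) :
    A ⊆ B := by
  obtain ⟨D, hD, hAD⟩ := (isLUB_join π ρ).1 (by simp : ρ ∈ ({π, ρ} : Set _)) hA
  rwa [(join π ρ).eq_of_mem_parts hD hB (hAD ha) haB] at hAD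

/-- A set closed under two partitions contains the blocks of their join that it meets. -/
theorem join_block_subset {π ρ : Finpartition (univ : Finset α)} {B S : Finset α}
    (hB : B ∈ (join π ρ).parts)
    (hπ : ∀ a b, π.part a = π.part b → a ∈ S → b ∈ S)
    (hρ : ∀ a b, ρ.part a = ρ.part b → a ∈ S → b ∈ S)
    {a : α} (haB : a ∈ B) (haS : a ∈ S) : B ⊆ S := by
  classical
  intro b hb
  rw [← (join π ρ).part_eq_of_mem hB haB] at hb
  have hab : (Setoid.ker π.part ⊔ Setoid.ker ρ.part) a b := by
    unfold join at hb
    exact Finpartition.mem_part_ofSetoid_iff_rel.1 hb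
  have hle : Setoid.ker π.part ⊔ Setoid.ker ρ.part ≤ Setoid.ker (· ∈ S) := by
    refine sup_le ?_ ?_
    · intro x y hxy
      exact propext ⟨hπ x y hxy, hπ y x (Eq.symm hxy)⟩
    · intro x y hxy
      exact propext ⟨hρ x y hxy, hρ y x (Eq.symm hxy)⟩
  exact (iff_of_eq (hle hab)).1 haS

/-- A word measurable with respect to `ρ` on a block of `π ∨ ρ` links the blocks of `π`
together: the letter sets of these blocks form a connected hypergraph. -/
theorem card_image_word_le {π ρ : Finpartition (univ : Finset α)} {B : Finset α}
    (hB : B ∈ (join π ρ).parts) {n : ℕ} {j : {a // a ∈ B} → Fin n}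
    (hj : j ∈ measurableWords ρ B n) :
    #(univ.image j) ≤ 1 + ∑ A ∈ blocksIn π B, (#((A.subtype (· ∈ B)).image j) - 1) := by
  classical
  have hj' : ∀ D ∈ blocksIn ρ B, ∀ a b : {a // a ∈ B}, (a : α) ∈ D → (b : α) ∈ D →
      j a = j b := by
    simpa [measurableWords] using hj
  let im : Finset α → Finset (Fin n) := fun A => (A.subtype (· ∈ B)).image j
  have mem_im : ∀ {A : Finset α} (a : {a // a ∈ B}), (a : α) ∈ A → j a ∈ im A := fun a ha =>
    mem_image_of_mem j (mem_subtype.2 ha)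
  have mem_blocks : ∀ {A : Finset α}, A ∈ blocksIn π B ↔ A ∈ π.parts ∧ A ⊆ B := by
    simp [blocksIn]
  have part_mem : ∀ a : α, a ∈ B → π.part a ∈ blocksIn π B := fun a ha =>
    have h1 := π.part_mem.2 (mem_univ a)
    mem_blocks.2 ⟨h1, subset_of_mem_join_left h1 hB (π.mem_part (mem_univ a)) ha⟩
  -- Subfamilies of blocks that satisfy the desired bound. A largest one absorbs every block sharing
  -- a letter with it, so its union is closed under both partitions and contains `B`.
  let good : Finset (Finset (Finset α)) := (blocksIn π B).powerset.filter fun T =>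
    T.Nonempty ∧ #(T.biUnion im) ≤ 1 + ∑ A ∈ T, (#(im A) - 1)
  obtain ⟨b₀, hb₀⟩ := (join π ρ).nonempty_of_mem_parts hB
  have hgood : good.Nonempty := by
    refine ⟨{π.part b₀}, mem_filter.2 ⟨?_, by simp, ?_⟩⟩
    · simpa using part_mem b₀ hb₀
    · rw [singleton_biUnion, sum_singleton]
      omega
  obtain ⟨T, hT, hmax⟩ := Finset.exists_max_image good card hgood
  simp only [good, mem_filter, mem_powerset] at hT
  obtain ⟨hTsub, ⟨A₀, hA₀⟩, hTcard⟩ := hT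
  have absorb : ∀ A ∈ blocksIn π B, ∀ x ∈ im A, x ∈ T.biUnion im → A ∈ T := by
    intro A hA x hxA hxT
    by_contra hAT
    have hins : insert A T ∈ good := by
      refine mem_filter.2 ⟨mem_powerset.2 (insert_subset hA hTsub), by simp, ?_⟩
      rw [biUnion_insert, sum_insert hAT]
      have h1 := card_union_add_card_inter (im A) (T.biUnion im)
      have h2 : 0 < #(im A ∩ T.biUnion im) := card_pos.2 ⟨x, mem_inter.2 ⟨hxA, hxT⟩⟩
      omega
    have := hmax _ hins
    rw [card_insert_of_notMem hAT] at this
    omega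
  have hcover : B ⊆ T.biUnion id := by
    obtain ⟨a₀, ha₀⟩ := π.nonempty_of_mem_parts (mem_blocks.1 (hTsub hA₀)).1
    refine join_block_subset hB ?_ ?_ ((mem_blocks.1 (hTsub hA₀)).2 ha₀)
      (mem_biUnion.2 ⟨A₀, hA₀, ha₀⟩)
    · intro a b hab ha
      obtain ⟨A, hA, haA⟩ := mem_biUnion.1 ha
      refine mem_biUnion.2 ⟨A, hA, ?_⟩
      rw [id, ← π.part_eq_of_mem (mem_blocks.1 (hTsub hA)).1 haA, hab]
      exact π.mem_part (mem_univ b)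
    · intro a b hab ha
      obtain ⟨A, hA, haA⟩ := mem_biUnion.1 ha
      have haB : a ∈ B := (mem_blocks.1 (hTsub hA)).2 haA
      have hD := ρ.part_mem.2 (mem_univ a)
      have haD := ρ.mem_part (mem_univ a)
      have hbD : b ∈ ρ.part a := hab ▸ ρ.mem_part (mem_univ b)
      have hDB := subset_of_mem_join_right hD hB haD haB
      have hbB := hDB hbD
      have hjab : j ⟨a, haB⟩ = j ⟨b, hbB⟩ :=
        hj' _ (mem_filter.2 ⟨hD, hDB⟩) ⟨a, haB⟩ ⟨b, hbB⟩ haD hbD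
      have hbπ := π.mem_part (mem_univ b)
      refine mem_biUnion.2 ⟨π.part b, absorb _ (part_mem b hbB) (j ⟨b, hbB⟩)
        (mem_im ⟨b, hbB⟩ hbπ) ?_, hbπ⟩
      rw [← hjab]
      exact mem_biUnion.2 ⟨A, hA, mem_im ⟨a, haB⟩ haA⟩
  have himage : univ.image j ⊆ T.biUnion im := by
    intro x hx
    obtain ⟨a, _, rfl⟩ := mem_image.1 hx
    obtain ⟨A, hA, haA⟩ := mem_biUnion.1 (hcover a.2)
    exact mem_biUnion.2 ⟨A, hA, mem_im a haA⟩
  exact (card_le_card himage).trans (hTcard.trans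
    (Nat.add_le_add_left (sum_le_sum_of_subset hTsub) 1))

end Connectivity

/-! ### Assembly of the bound. -/

/-- The sum over measurable words of the products of the cumulants is `O(n)`, for any two
partitions and whatever the parities of their blocks. -/
theorem exists_sum_prod_norm_wordCumulant_le {α : Type*} [Fintype α] [LinearOrder α]
    {π ρ : Finpartition (univ : Finset α)} {B : Finset α} (hB : B ∈ (join π ρ).parts) :
    ∃ K : ℝ, 0 ≤ K ∧ ∀ n : ℕ, 0 < n →
      ∑ j ∈ measurableWords ρ B n, ∏ A ∈ blocksIn π B, ‖wordCumulant j A‖ ≤ K * n := by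
  obtain ⟨K, hK, h⟩ := exists_norm_wordCumulant_le B
  refine ⟨K ^ #(blocksIn π B) * (Fintype.card {a // a ∈ B}).factorial, by positivity,
    fun n hn => ?_⟩
  have hn' : (0 : ℝ) < n := by exact_mod_cast hn
  have hn1 : (1 : ℝ) ≤ n := by exact_mod_cast hn
  have hword : ∀ j ∈ measurableWords ρ B n, ∏ A ∈ blocksIn π B, ‖wordCumulant j A‖ ≤
      K ^ #(blocksIn π B) * n * ((n : ℝ)⁻¹) ^ #(univ.image j) := by
    intro j hj
    set e := ∑ A ∈ blocksIn π B, (#((A.subtype (· ∈ B)).image j) - 1) with he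
    have h1 : (∏ A ∈ blocksIn π B, ‖wordCumulant j A‖) * (n : ℝ) ^ e ≤
        K ^ #(blocksIn π B) := by
      rw [he, ← Finset.prod_pow_eq_pow_sum, ← Finset.prod_mul_distrib]
      refine (Finset.prod_le_prod (fun _ _ => by positivity) fun A hA => ?_).trans
        (le_of_eq (Finset.prod_const K))
      have hA' := mem_filter.1 hA
      exact h n j A hA'.2 (π.nonempty_of_mem_parts hA'.1)
    have h2 : (n : ℝ) ^ #(univ.image j) ≤ n * (n : ℝ) ^ e := by
      rw [← pow_succ', add_comm]
      exact pow_le_pow_right₀ hn1 (card_image_word_le hB hj)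
    rw [inv_pow, ← div_eq_mul_inv, le_div_iff₀ (by positivity)]
    calc _ ≤ (∏ A ∈ blocksIn π B, ‖wordCumulant j A‖) * (n * (n : ℝ) ^ e) := by
          gcongr
      _ = ((∏ A ∈ blocksIn π B, ‖wordCumulant j A‖) * (n : ℝ) ^ e) * n := by ring
      _ ≤ K ^ #(blocksIn π B) * n := by gcongr
  calc _ ≤ ∑ j ∈ measurableWords ρ B n,
        K ^ #(blocksIn π B) * n * ((n : ℝ)⁻¹) ^ #(univ.image j) := Finset.sum_le_sum hword
    -- Measurability has served its purpose in `hword`; the weighted sum over all words is already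
    -- bounded.
    _ ≤ ∑ j : {a // a ∈ B} → Fin n,
        K ^ #(blocksIn π B) * n * ((n : ℝ)⁻¹) ^ #(univ.image j) :=
      Finset.sum_le_sum_of_subset_of_nonneg (subset_univ _) fun _ _ _ => by positivity
    _ ≤ K ^ #(blocksIn π B) * n * (Fintype.card {a // a ∈ B}).factorial := by
      rw [← Finset.mul_sum]
      gcongr
      exact sum_inv_pow_card_image_le hn
    _ = _ := by ring

end SpearmanRank

theorem proposition4p2 (k : ℕ)
    (π π₁ : Finpartition (Finset.univ : Finset (Fin (2 * k))))
    (hπ : ∀ A ∈ π.parts, Even A.card)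
    (hπ₁ : ∀ D ∈ π₁.parts, D.card = 2)
    (B : Finset (Fin (2 * k))) (hB : B ∈ (SpearmanRank.join π π₁).parts) :
    (fun n : ℕ => ∑ j ∈ SpearmanRank.measurableWords π₁ B n,
        ∏ A ∈ SpearmanRank.blocksIn π B, ‖SpearmanRank.wordCumulant j A‖)
      =O[Filter.atTop]
    (fun n : ℕ => (n : ℝ) ^ (1 + ∑ A ∈ SpearmanRank.blocksIn π B,
        if 2 ≤ SpearmanRank.halfCard A then SpearmanRank.halfCard A - 2 else 0)) := by
  obtain ⟨K, hK, h⟩ := SpearmanRank.exists_sum_prod_norm_wordCumulant_le hB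
  refine IsBigO.of_bound K ?_
  filter_upwards [Filter.eventually_gt_atTop 0] with n hn
  have hn1 : (1 : ℝ) ≤ n := by exact_mod_cast hn
  rw [Real.norm_of_nonneg (Finset.sum_nonneg fun _ _ =>
    Finset.prod_nonneg fun _ _ => norm_nonneg _), Real.norm_of_nonneg (by positivity)]
  refine (h n hn).trans (mul_le_mul_of_nonneg_left ?_ hK)
  -- The exponent is at least 1, so `n` is at most the claimed power.
  exact le_self_pow₀ hn1 (by omega)
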